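/- Let $d\ge 2$ and let $E=(\mathbb R^d,\|\cdot\|_E)$ be a $d$-dimensional real normed space, with dual $E^*=(\mathbb R^d,\|\cdot\|_{E^*})$; $\mathbb R^d$ carries Lebesgue measure. Notation: $\mathcal D(\mathbb R^d)$ is the space of real-valued $C^\infty$ functions with compact support (test functions). For a Lipschitz function $f:E\to\mathbb R$, $\|f\|_{lip}$ is its least Lipschitz constant with respect to $\|\cdot\|_E$. $\mathrm{Lip}_0(E)$ is the Banach space of Lipschitz functions $F:E\to\mathbb R$ with $F(0)=0$, normed by $\|\cdot\|_{lip}$; it is canonically the dual of the Lipschitz-free space $\mathcal F(E)=\overline{\mathrm{span}}\{\delta(x):x\in E\}\subset \mathrm{Lip}_0(E)^*$, where $\delta(x)(F)=F(x)$, and "weak$^*$" refers to this duality. $L^\infty(\mathbb R^d,E^*)$ is the space of (classes of) essentially bounded measurable maps into $E^*$ with norm $\operatorname{ess\,sup}_x\|f(x)\|_{E^*}$; $C_0(\mathbb R^d,E^*)$ is its subspace of continuous maps vanishing at infinity; and $$X(E)=\Big\{f=(f_1,\dots,f_d)\in L^\infty(\mathbb R^d,E^*):\ \int_{\mathbb R^d}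 f_j\,\partial_i\varphi=\int_{\mathbb R^d} f_i\,\partial_j\varphi\ \text{ for all } i,j\in\{1,\dots,d\},\ \varphi\in\mathcal D(\mathbb R^d)\Big\},$$ i.e. $\partial_i f_j=\partial_j f_i$ in the sense of distributions for all $i,j$. Then: (i) For every $F\in\mathrm{Lip}_0(E)$ there is a sequence $(F_n)$ in $\mathcal D(\mathbb R^d)$ such that $\|F_n\|_{lip}\le\|F\|_{lip}$ for all $n$ and the sequence $(F_n-F_n(0))$ converges weak$^*$ to $F$ in $\mathrm{Lip}_0(E)$. (ii) The set $\{\nabla\varphi:\varphi\in\mathcal D(\mathbb R^d)\}$ is contained in, and norm-dense in, $C_0(\mathbb R^d,E^*)\cap X(E)$. (iii) For every $g\in C_0(\mathbb R^d,E^*)$, $$\operatorname{dist}(g,X(E))=\operatorname{dist}\big(g,X(E)\cap C_0(\mathbb R^d,E^*)\big).$$ The density in (ii) and the distances in (iii) are taken with respect to the norm of $L^\infty(\mathbb R^d,E^*)$. -/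

import Mathlib

open Filter Topology MeasureTheory
open scoped ENNReal NNReal Distributions ZeroAtInfty

noncomputable section

/-! ### Lipschitz functions and the Lipschitz-free space -/

section LipschitzFree

variable {E : Type*} [NormedAddCommGroup E]

/-- The Lipschitz constant of `f : E → ℝ`: the least `K ≥ 0` such that `f` is `K`-Lipschitz
(only used for Lipschitz functions `f`). -/
def lipConst (f : E → ℝ) : ℝ :=
  sInf {K : ℝ | 0 ≤ K ∧ ∀ x y, |f x - f y| ≤ K * ‖x - y‖}

theorem lipConst_nonneg (f : E → ℝ) : 0 ≤ lipConst f :=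
  Real.sInf_nonneg fun _ h => h.1

theorem lipConst_le {f : E → ℝ} {K : ℝ} (hK : 0 ≤ K) (h : ∀ x y, |f x - f y| ≤ K * ‖x - y‖) :
    lipConst f ≤ K :=
  csInf_le ⟨0, fun _ h => h.1⟩ ⟨hK, h⟩

/-- For a Lipschitz function, `lipConst f` is itself a Lipschitz constant. -/
theorem abs_sub_le_lipConst {f : E → ℝ} (hf : ∃ K, LipschitzWith K f) (x y : E) :
    |f x - f y| ≤ lipConst f * ‖x - y‖ := by
  obtain ⟨K, hK⟩ := hf
  rcases (norm_nonneg (x - y)).eq_or_lt with h | h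
  · have hxy : x = y := sub_eq_zero.1 (norm_eq_zero.1 h.symm)
    simp [hxy]
  · rw [← div_le_iff₀ h]
    refine le_csInf ⟨K, K.2, fun a b => ?_⟩ fun L hL => ?_
    · simpa [Real.dist_eq, dist_eq_norm] using hK.dist_le_mul a b
    · rw [div_le_iff₀ h]
      exact hL.2 x y

variable (E) in
/-- The real vector space of Lipschitz functions on `E` vanishing at the origin. -/
def lip0Submodule : Submodule ℝ (E → ℝ) where
  carrier := {f | (∃ K, LipschitzWith K f) ∧ f 0 = 0}
  add_mem' := by
    rintro f g ⟨⟨K, hK⟩, hf⟩ ⟨⟨L, hL⟩, hg⟩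
    exact ⟨⟨K + L, hK.add hL⟩, by simp [hf, hg]⟩
  zero_mem' := ⟨⟨0, LipschitzWith.const 0⟩, rfl⟩
  smul_mem' := by
    rintro c f ⟨⟨K, hK⟩, hf⟩
    exact ⟨⟨‖c‖₊ * K, (lipschitzWith_smul c).comp hK⟩, by simp [hf]⟩

variable (E) in
/-- `Lip₀(E)`: Lipschitz functions `E → ℝ` vanishing at the origin.  It is a type of its own, so
that its topology is the one of the Lipschitz-constant norm and not that of pointwise
convergence. -/
def Lip0 : Type _ := ↥(lip0Submodule E)

namespace Lip0

instance : AddCommGroup (Lip0 E) := inferInstanceAs (AddCommGroup ↥(lip0Submodule E))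

instance : Module ℝ (Lip0 E) := inferInstanceAs (Module ℝ ↥(lip0Submodule E))

instance : CoeFun (Lip0 E) fun _ => E → ℝ := ⟨fun F => Subtype.val F⟩

theorem lipschitz (F : Lip0 E) : ∃ K, LipschitzWith K (F : E → ℝ) := F.2.1

theorem map_zero (F : Lip0 E) : F 0 = 0 := F.2.2

theorem ext {F G : Lip0 E} (h : ∀ x, F x = G x) : F = G := Subtype.ext (funext h)

theorem add_apply (F G : Lip0 E) (x : E) : (F + G) x = F x + G x := rfl

theorem smul_apply (c : ℝ) (F : Lip0 E) (x : E) : (c • F) x = c * F x := rfl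

theorem zero_apply (x : E) : (0 : Lip0 E) x = 0 := rfl

/-- The norm of `Lip₀(E)` is the Lipschitz constant. -/
instance : Norm (Lip0 E) := ⟨fun F => lipConst F⟩

theorem norm_def (F : Lip0 E) : ‖F‖ = lipConst F := rfl

theorem abs_apply_le (F : Lip0 E) (x : E) : |F x| ≤ ‖F‖ * ‖x‖ := by
  simpa [F.map_zero, norm_def] using abs_sub_le_lipConst F.lipschitz x 0

theorem norm_smul_le' (c : ℝ) (F : Lip0 E) : ‖c • F‖ ≤ |c| * ‖F‖ := by
  refine lipConst_le (mul_nonneg (abs_nonneg c) (lipConst_nonneg _)) fun x y => ?_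
  rw [smul_apply, smul_apply, ← mul_sub, abs_mul, mul_assoc]
  exact mul_le_mul_of_nonneg_left (abs_sub_le_lipConst F.lipschitz x y) (abs_nonneg c)

theorem normedSpaceCore : NormedSpace.Core ℝ (Lip0 E) where
  norm_nonneg F := lipConst_nonneg _
  norm_smul c F := by
    refine le_antisymm (norm_smul_le' c F) ?_
    rcases eq_or_ne c 0 with rfl | hc
    · simpa [norm_def] using lipConst_nonneg _
    · have h := norm_smul_le' c⁻¹ (c • F)
      rw [inv_smul_smul₀ hc, abs_inv] at h
      rwa [Real.norm_eq_abs, ← le_inv_mul_iff₀ (abs_pos.2 hc)]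
  norm_triangle F G := by
    refine lipConst_le (add_nonneg (lipConst_nonneg _) (lipConst_nonneg _)) fun x y => ?_
    rw [add_apply, add_apply, add_sub_add_comm, add_mul]
    exact (abs_add_le _ _).trans (add_le_add (abs_sub_le_lipConst F.lipschitz x y)
      (abs_sub_le_lipConst G.lipschitz x y))
  norm_eq_zero_iff F := by
    constructor
    · intro h
      refine ext fun x => ?_
      have := F.abs_apply_le x
      rw [h, zero_mul] at this
      exact abs_nonpos_iff.1 this
    · rintro rfl
      exact le_antisymm (lipConst_le le_rfl (by simp [zero_apply])) (lipConst_nonneg _)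

instance : NormedAddCommGroup (Lip0 E) := .ofCore normedSpaceCore

instance : NormedSpace ℝ (Lip0 E) := .ofCore normedSpaceCore

/-- The evaluation functional `δ(x) ∈ Lip₀(E)*`, `δ(x)(F) = F(x)`. -/
def delta (x : E) : StrongDual ℝ (Lip0 E) :=
  LinearMap.mkContinuous
    { toFun := fun F => F x
      map_add' := fun F G => add_apply F G x
      map_smul' := fun c F => smul_apply c F x }
    ‖x‖ (fun F => by simpa [mul_comm] using F.abs_apply_le x)

end Lip0

variable (E) in
/-- The Lipschitz-free space over `E`: the closed linear span of the evaluation functionals in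
`Lip₀(E)*`. -/
def lipschitzFree : Submodule ℝ (StrongDual ℝ (Lip0 E)) :=
  (Submodule.span ℝ (Set.range (Lip0.delta (E := E)))).topologicalClosure

/-- A function in `Lip₀(E)` as an element of the dual of the Lipschitz-free space, equipped with
the weak* topology: `F` acts by `γ ↦ γ(F)`. -/
def Lip0.toWeakDual (F : Lip0 E) : WeakDual ℝ (lipschitzFree E) :=
  StrongDual.toWeakDual
    ((NormedSpace.inclusionInDoubleDual ℝ (Lip0 E) F).comp (lipschitzFree E).subtypeL)

end LipschitzFree

/-! ### Test functions, gradients, `C₀` and `X(E)` -/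

section Fields

variable {E : Type*} [NormedAddCommGroup E] [NormedSpace ℝ E]

/-- The normalized test function `φ - φ(0)` as an element of `Lip₀(E)`. -/
def testToLip0 (φ : 𝓓((⊤ : TopologicalSpace.Opens E), ℝ)) : Lip0 E :=
  ⟨fun x => φ x - φ 0,
    by
      obtain ⟨K, hK⟩ := φ.contDiff.lipschitzWith_of_hasCompactSupport φ.hasCompactSupport
        (by simp)
      exact ⟨K, fun x y => by simpa [edist_sub_right] using hK x y⟩,
    sub_self _⟩

/-- The gradient of a test function, as an `E*`-valued continuous function vanishing at
infinity. -/
def testGradient (φ : 𝓓((⊤ : TopologicalSpace.Opens E), ℝ)) : C₀(E, StrongDual ℝ E) where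
  toFun := fderiv ℝ φ
  continuous_toFun := φ.contDiff.continuous_fderiv (by simp)
  zero_at_infty' := by
    have h : HasCompactSupport (fderiv ℝ φ) := φ.hasCompactSupport.fderiv ℝ
    exact h.is_zero_at_infty

variable [FiniteDimensional ℝ E] [MeasurableSpace E] [BorelSpace E]

/-- The class in `L^∞(μ; E*)` of a continuous `E*`-valued function vanishing at infinity. -/
def c0ToLinfty (μ : Measure E) (g : C₀(E, StrongDual ℝ E)) : Lp (StrongDual ℝ E) ∞ μ :=
  MemLp.toLp g (memLp_top_of_bound (map_continuous g).aestronglyMeasurable ‖g.toBCF‖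
    (Eventually.of_forall fun x => g.toBCF.norm_coe_le_norm x))

/-- `C₀(ℝ^d, E*)` as a subset of `L^∞(μ; E*)`. -/
def c0Set (μ : Measure E) : Set (Lp (StrongDual ℝ E) ∞ μ) :=
  Set.range (c0ToLinfty μ)

/-- The set of gradients of test functions as a subset of `L^∞(μ; E*)`. -/
def gradientSet (μ : Measure E) : Set (Lp (StrongDual ℝ E) ∞ μ) :=
  Set.range fun φ : 𝓓((⊤ : TopologicalSpace.Opens E), ℝ) => c0ToLinfty μ (testGradient φ)

/-- `X(E)`: the fields `f ∈ L^∞(ℝ^d, E*)` with `∂ᵢ fⱼ = ∂ⱼ fᵢ` in the sense of distributions for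
all `i, j`.  The basis `b` identifies `E` with `ℝ^d`; `b.addHaar` is the corresponding Lebesgue
measure, `f x (b i)` is the `i`-th coordinate of `f x ∈ E*`, and `fderiv ℝ φ x (b i)` is the `i`-th
partial derivative of `φ`. -/
def curlFree {d : ℕ} (b : Module.Basis (Fin d) ℝ E) :
    Set (Lp (StrongDual ℝ E) ∞ b.addHaar) :=
  {f | ∀ i j : Fin d, ∀ φ : 𝓓((⊤ : TopologicalSpace.Opens E), ℝ),
    ∫ x, f x (b j) * fderiv ℝ φ x (b i) ∂b.addHaar =
      ∫ x, f x (b i) * fderiv ℝ φ x (b j) ∂b.addHaar}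

end Fields

end

/-! Two operations do not enlarge increments of a function: mollification, an average of translates,
and lattice truncation by a cone, since max and min respect Lipschitz bounds. Truncating and then
mollifying a Lipschitz function gives test functions with no larger constant that approximate it
locally uniformly up to constants. This yields (i), because on bounded sets pointwise convergence
implies weak* convergence.

Density in (ii) and the equality in (iii) both come from `exists_testGradient_dist_le`: if `f` in
X(E) is at distance `r` from `g` in C₀, some test gradient is within `r + ε` of `g`; density is the
case `f = g`. To prove it, mollify `f` at a scale where `g` is nearly constant. The result is a
smooth closed field, hence a gradient ∇F, still `(r + ε)`-close to `g`. Then F must be cut off.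
Multiplying by a cutoff could spoil the gradient, as F may grow linearly; instead F is truncated by
a cone of slope slightly above `r`. Far out `g` is small, so F already has increments below that
slope and the truncation keeps them so. A last mollification gives a test function. -/

open scoped Convolution
open Metric

/-! ### Increments and derivatives of mollifications -/

section Mollification

variable {E : Type*} [NormedAddCommGroup E] [NormedSpace ℝ E] [FiniteDimensional ℝ E]
  [MeasurableSpace E] [BorelSpace E] (μ : Measure E) [μ.IsAddHaarMeasure]

/-- The convolution of a function with a normalized smooth bump function. -/
noncomputable def mollify {V : Type*} [NormedAddCommGroup V] [NormedSpace ℝ V]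
    (ρ : ContDiffBump (0 : E)) (G : E → V) : E → V :=
  ρ.normed μ ⋆[ContinuousLinearMap.lsmul ℝ ℝ, μ] G

/-- If all translates of an increment of `G` by vectors of the support of the bump are close to
`c`, then so is the increment of the mollification. -/
theorem abs_mollify_sub_sub_le (ρ : ContDiffBump (0 : E)) {G : E → ℝ} (hG : Continuous G)
    {x y : E} {c K : ℝ} (h : ∀ t ∈ ball (0 : E) ρ.rOut, |G (y - t) - G (x - t) - c| ≤ K) :
    |mollify μ ρ G y - mollify μ ρ G x - c| ≤ K := by
  have hint : ∀ z : E, Integrable (fun t => ρ.normed μ t * G (z - t)) μ := fun z =>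
    Continuous.integrable_of_hasCompactSupport
      (ρ.continuous_normed.mul (hG.comp (continuous_const.sub continuous_id)))
      ρ.hasCompactSupport_normed.mul_right
  have hc : Integrable (fun t => ρ.normed μ t * c) μ := ρ.integrable_normed.mul_const c
  -- The bump has integral one, so the constants `c` and `K` can be moved under the integral.
  have heq : mollify μ ρ G y - mollify μ ρ G x - c =
      ∫ t, ρ.normed μ t * (G (y - t) - G (x - t) - c) ∂μ := by
    have h1 : c = ∫ t, ρ.normed μ t * c ∂μ := by
      rw [integral_mul_const, ρ.integral_normed, one_mul]
    conv_lhs => rw [h1]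
    change (∫ t, ρ.normed μ t * G (y - t) ∂μ) - (∫ t, ρ.normed μ t * G (x - t) ∂μ) - _ = _
    rw [← integral_sub (hint y) (hint x),
      ← integral_sub (by exact (hint y).sub (hint x)) hc]
    exact integral_congr_ae (Eventually.of_forall fun t => by simp only; ring)
  have hK : K = ∫ t, ρ.normed μ t * K ∂μ := by
    rw [integral_mul_const, ρ.integral_normed, one_mul]
  rw [heq, hK, ← Real.norm_eq_abs]
  refine norm_integral_le_of_norm_le (ρ.integrable_normed.mul_const K)
    (Eventually.of_forall fun t => ?_)
  rw [norm_mul, Real.norm_of_nonneg (ρ.nonneg_normed t)]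
  by_cases ht : t ∈ ball (0 : E) ρ.rOut
  · exact mul_le_mul_of_nonneg_left (h t ht) (ρ.nonneg_normed t)
  · rw [← ρ.support_normed_eq (μ := μ), Function.notMem_support] at ht
    simp [ht]

theorem abs_mollify_sub_le_of_lipschitz (ρ : ContDiffBump (0 : E)) {G : E → ℝ} {L : ℝ}
    (hG : Continuous G) (hL : ∀ x y, |G x - G y| ≤ L * ‖x - y‖) (x y : E) :
    |mollify μ ρ G x - mollify μ ρ G y| ≤ L * ‖x - y‖ := by
  have := abs_mollify_sub_sub_le μ ρ hG (x := y) (y := x) (c := 0) (K := L * ‖x - y‖)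
    fun t _ => by simpa using hL (x - t) (y - t)
  simpa using this

/-- If `G - A` is `K`-Lipschitz near `x` for a linear form `A`, then the derivative at `x` of a
mollification of `G` at a small scale is `K`-close to `A`. -/
theorem norm_fderiv_mollify_sub_le (ρ : ContDiffBump (0 : E)) {G : E → ℝ} (hG : Continuous G)
    (A : StrongDual ℝ E) {x : E} {K δ : ℝ} (hK : 0 ≤ K) (hδ : ρ.rOut < δ)
    (h : ∀ y ∈ ball x δ, ∀ z ∈ ball x δ, |G y - G z - A (y - z)| ≤ K * ‖y - z‖) :
    ‖fderiv ℝ (mollify μ ρ G) x - A‖ ≤ K := by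
  have hd : DifferentiableAt ℝ (mollify μ ρ G) x :=
    (ρ.hasCompactSupport_normed.hasFDerivAt_convolution_left _ (ρ.contDiff_normed)
      hG.locallyIntegrable x).differentiableAt
  have := hd.hasFDerivAt.sub A.hasFDerivAt
  refine this.le_of_lip' hK ?_
  filter_upwards [ball_mem_nhds x (sub_pos.2 hδ)] with y hy
  have h2 : ∀ t ∈ ball (0 : E) ρ.rOut, |G (y - t) - G (x - t) - A (y - x)| ≤ K * ‖y - x‖ := by
    intro t ht
    rw [mem_ball_zero_iff] at ht
    rw [mem_ball_iff_norm] at hy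
    have := h (y - t) ?_ (x - t) ?_
    · simpa using this
    · rw [mem_ball_iff_norm]
      have := norm_sub_le (y - x) t
      rw [show y - t - x = y - x - t by abel]
      linarith
    · rw [mem_ball_iff_norm]
      simpa using ht.trans hδ
  have h3 := abs_mollify_sub_sub_le μ ρ hG h2
  rw [map_sub] at h3
  simp only [Pi.sub_apply, Real.norm_eq_abs]
  convert h3 using 2
  ring

/-- The mollification of a compactly supported continuous function, as a test function. -/
noncomputable def mollifyTest (ρ : ContDiffBump (0 : E)) {G : E → ℝ} (hG : Continuous G)
    (hc : HasCompactSupport G) : 𝓓((⊤ : TopologicalSpace.Opens E), ℝ) where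
  toFun := mollify μ ρ G
  contDiff' := ρ.hasCompactSupport_normed.contDiff_convolution_left _ ρ.contDiff_normed
    hG.locallyIntegrable
  hasCompactSupport' := ρ.hasCompactSupport_normed.convolution _ hc
  tsupport_subset' := by simp

theorem coe_mollifyTest (ρ : ContDiffBump (0 : E)) {G : E → ℝ} (hG : Continuous G)
    (hc : HasCompactSupport G) : ⇑(mollifyTest μ ρ hG hc) = mollify μ ρ G := rfl

end Mollification

/-! ### Truncation by a cone -/

/-- Up to a constant, a continuous function on a ball extends to a continuous compactly supported
function whose increments are bounded by `s ‖x - y‖` wherever those of `F` are. -/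
theorem exists_hasCompactSupport_truncation {E : Type*} [NormedAddCommGroup E] [NormedSpace ℝ E]
    [FiniteDimensional ℝ E] {F : E → ℝ} (hF : Continuous F) {s : ℝ} (hs : 0 < s) (R : ℝ) :
    ∃ (G : E → ℝ) (C : ℝ), Continuous G ∧ HasCompactSupport G ∧
      (∀ x ∈ closedBall (0 : E) R, G x = F x + C) ∧
      ∀ x y, |F x - F y| ≤ s * ‖x - y‖ → |G x - G y| ≤ s * ‖x - y‖ := by
  obtain ⟨K, hK⟩ := (isCompact_closedBall (0 : E) R).exists_bound_of_continuousOn hF.continuousOn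
  -- On the ball, `0 ≤ F + K ≤ 2K`, and the cone is at least `2K`, so neither truncation acts.
  -- Beyond radius `(2K + sR)/s` the cone is negative and the maximum is zero.
  refine ⟨fun x => max 0 (min (F x + K) (2 * K + s * R - s * ‖x‖)), K, by fun_prop, ?_, ?_, ?_⟩
  · refine HasCompactSupport.intro (isCompact_closedBall (0 : E) ((2 * K + s * R) / s))
      fun x hx => ?_
    rw [mem_closedBall_zero_iff, not_le, div_lt_iff₀ hs] at hx
    exact max_eq_left ((min_le_right _ _).trans (by linarith))
  · intro x hx
    have h1 := abs_le.1 (hK x hx)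
    have h2 := mul_le_mul_of_nonneg_left (mem_closedBall_zero_iff.1 hx) hs.le
    simp only
    rw [min_eq_left (by linarith), max_eq_right (by linarith)]
  · intro x y h
    have h3 : |(2 * K + s * R - s * ‖x‖) - (2 * K + s * R - s * ‖y‖)| ≤ s * ‖x - y‖ := by
      have := mul_le_mul_of_nonneg_left (abs_norm_sub_norm_le y x) hs.le
      rw [norm_sub_rev y x] at this
      rw [show (2 * K + s * R - s * ‖x‖) - (2 * K + s * R - s * ‖y‖) = s * (‖y‖ - ‖x‖) by ring,
        abs_mul, abs_of_pos hs]
      exact this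
    have h4 : |F x + K - (F y + K)| ≤ s * ‖x - y‖ := by simpa using h
    calc _ ≤ max |(0 : ℝ) - 0| _ := abs_max_sub_max_le_max _ _ _ _
      _ ≤ s * ‖x - y‖ := max_le (by simpa using by positivity)
        ((abs_min_sub_min_le_max _ _ _ _).trans (max_le h4 h3))

/-! ### Weak* convergence on bounded sets -/

section WeakStar

variable {E : Type*} [NormedAddCommGroup E]

/-- On bounded sets of `Lip₀(E)`, pointwise convergence implies weak* convergence. -/
theorem Lip0.tendsto_toWeakDual_of_bounded {F : Lip0 E} {Fn : ℕ → Lip0 E} {C : ℝ}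
    (hC : ∀ n, ‖Fn n‖ ≤ C) (h : ∀ x, Tendsto (fun n => Fn n x) atTop (𝓝 (F x))) :
    Tendsto (fun n => (Fn n).toWeakDual) atTop (𝓝 F.toWeakDual) := by
  rw [tendsto_iff_forall_eval_tendsto_topDualPairing]
  rintro ⟨γ, hγ⟩
  change Tendsto (fun n => γ (Fn n)) atTop (𝓝 (γ F))
  have hspan : ∀ γ ∈ Submodule.span ℝ (Set.range (Lip0.delta (E := E))),
      Tendsto (fun n => γ (Fn n)) atTop (𝓝 (γ F)) := by
    intro γ hγ
    induction hγ using Submodule.span_induction with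
    | mem γ hγ => obtain ⟨x, rfl⟩ := hγ; exact h x
    | zero => exact tendsto_const_nhds
    | add γ η _ _ h1 h2 => exact h1.add h2
    | smul c γ _ h1 => exact h1.const_smul c
  have hC0 : 0 ≤ C := (norm_nonneg _).trans (hC 0)
  rw [Metric.tendsto_atTop]
  intro ε hε
  have hD : 0 < C + ‖F‖ + 1 := by positivity
  obtain ⟨η, hη, hγη⟩ := Metric.mem_closure_iff.1 hγ (ε / 2 / (C + ‖F‖ + 1)) (by positivity)
  obtain ⟨N, hN⟩ := Metric.tendsto_atTop.1 (hspan η hη) (ε / 2) (by positivity)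
  refine ⟨N, fun n hn => ?_⟩
  have h1 := hN n hn
  rw [dist_eq_norm] at h1 hγη ⊢
  have h2 := ((γ - η).le_opNorm (Fn n - F)).trans (mul_le_mul hγη.le
    ((norm_sub_le _ _).trans (show ‖Fn n‖ + ‖F‖ ≤ C + ‖F‖ + 1 by linarith [hC n]))
    (norm_nonneg _) (by positivity))
  rw [div_mul_cancel₀ _ hD.ne'] at h2
  have h3 : γ (Fn n) - γ F = (γ - η) (Fn n - F) + (η (Fn n) - η F) := by
    simp only [map_sub, sub_apply]
    ring
  rw [h3]
  exact (norm_add_le _ _).trans_lt (by linarith)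

end WeakStar

/-! ### Weak* approximation by test functions -/

section Approximation

variable {E : Type*} [NormedAddCommGroup E] [NormedSpace ℝ E] [FiniteDimensional ℝ E]

/-- A Lipschitz function is, up to constants, a locally uniform limit of test functions with no
larger Lipschitz constant. -/
theorem exists_testFunction_near_lipschitz {F : E → ℝ} (hF : Continuous F) {L : ℝ} (hL : 0 < L)
    (h : ∀ x y, |F x - F y| ≤ L * ‖x - y‖) (R : ℝ) {ε : ℝ} (hε : 0 < ε) :
    ∃ (φ : 𝓓((⊤ : TopologicalSpace.Opens E), ℝ)) (C : ℝ),
      (∀ x y, |φ x - φ y| ≤ L * ‖x - y‖) ∧ ∀ x ∈ closedBall (0 : E) R, |φ x - (F x + C)| ≤ ε := by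
  let : MeasurableSpace E := borel E
  have : BorelSpace E := ⟨rfl⟩
  obtain ⟨G, C, hG, hc, hGF, hGL⟩ := exists_hasCompactSupport_truncation hF hL R
  have hGL' : ∀ x y, |G x - G y| ≤ L * ‖x - y‖ := fun x y => hGL x y (h x y)
  -- At radius `ε / L` an `L`-Lipschitz function moves by at most `ε`.
  let ρ : ContDiffBump (0 : E) := ⟨ε / L / 2, ε / L, by positivity, by
    have : 0 < ε / L := by positivity
    linarith⟩
  refine ⟨mollifyTest Measure.addHaar ρ hG hc, C, fun x y => ?_, fun x hx => ?_⟩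
  · exact abs_mollify_sub_le_of_lipschitz _ ρ hG hGL' x y
  · rw [← hGF x hx, ← Real.dist_eq]
    refine ρ.dist_normed_convolution_le hG.aestronglyMeasurable fun y hy => ?_
    rw [Real.dist_eq]
    refine (hGL' y x).trans ?_
    rw [mem_ball_iff_norm] at hy
    calc L * ‖y - x‖ ≤ L * (ε / L) := mul_le_mul_of_nonneg_left hy.le hL.le
      _ = ε := mul_div_cancel₀ _ hL.ne'

/-- The unit ball of `Lip₀(E)` is the sequential weak* closure of the test functions in it. -/
theorem Lip0.exists_seq_testFunction_tendsto (F : Lip0 E) :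
    ∃ Fn : ℕ → 𝓓((⊤ : TopologicalSpace.Opens E), ℝ), (∀ n, lipConst (Fn n) ≤ ‖F‖) ∧
      Tendsto (fun n => (testToLip0 (Fn n)).toWeakDual) atTop (𝓝 F.toWeakDual) := by
  rcases (norm_nonneg F).eq_or_lt with h0 | hL
  · have hF : F = 0 := norm_eq_zero.1 h0.symm
    have hzero : testToLip0 (0 : 𝓓((⊤ : TopologicalSpace.Opens E), ℝ)) = 0 :=
      Lip0.ext fun x => sub_self (0 : ℝ)
    refine ⟨fun _ => 0, fun _ => ?_, ?_⟩
    · exact lipConst_le (norm_nonneg F) fun x y => by simpa using by positivity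
    · simp only [hzero, hF]
      exact tendsto_const_nhds
  · obtain ⟨K, hK⟩ := F.lipschitz
    have hlip : ∀ x y, |F x - F y| ≤ ‖F‖ * ‖x - y‖ := abs_sub_le_lipConst F.lipschitz
    choose φ C hφL hφ using fun n : ℕ => exists_testFunction_near_lipschitz hK.continuous hL hlip
      n (ε := 1 / ((n : ℝ) + 1)) (by positivity)
    have hnorm : ∀ n, lipConst (φ n) ≤ ‖F‖ := fun n => lipConst_le hL.le (hφL n)
    refine ⟨φ, hnorm, Lip0.tendsto_toWeakDual_of_bounded (C := ‖F‖) (fun n => ?_) fun x => ?_⟩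
    · refine lipConst_le hL.le fun x y => ?_
      have := hφL n x y
      change |(φ n x - φ n 0) - (φ n y - φ n 0)| ≤ _
      rwa [sub_sub_sub_cancel_right]
    · rw [tendsto_iff_dist_tendsto_zero]
      -- The factor 2 counts the errors at `x` and at `0`; the constant `C n` cancels in the
      -- difference.
      have hlim : Tendsto (fun n : ℕ => 2 * (1 / ((n : ℝ) + 1))) atTop (𝓝 0) := by
        simpa using tendsto_one_div_add_atTop_nhds_zero_nat.const_mul (2 : ℝ)
      refine squeeze_zero' (Eventually.of_forall fun n => dist_nonneg) ?_ hlim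
      obtain ⟨N, hN⟩ := exists_nat_ge ‖x‖
      filter_upwards [eventually_ge_atTop N] with n hn
      have h1 := abs_le.1 (hφ n x (mem_closedBall_zero_iff.2
        (hN.trans (Nat.cast_le.2 hn))))
      have h2 := abs_le.1 (hφ n 0 (mem_closedBall_self n.cast_nonneg))
      rw [F.map_zero] at h2
      rw [Real.dist_eq]
      change |(φ n x - φ n 0) - F x| ≤ _
      rw [abs_le]
      constructor <;> linarith

end Approximation

/-! ### From closed fields to gradients of test functions -/

section CurlFree

variable {E : Type*} [NormedAddCommGroup E] [NormedSpace ℝ E] [FiniteDimensional ℝ E]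
  [MeasurableSpace E] [BorelSpace E] (μ : Measure E) [μ.IsAddHaarMeasure]

/-- The translated and reflected bump `y ↦ ρ (x - y)` as a test function. -/
noncomputable def bumpSubTest (ρ : ContDiffBump (0 : E)) (x : E) :
    𝓓((⊤ : TopologicalSpace.Opens E), ℝ) where
  toFun y := ρ.normed μ (x - y)
  contDiff' := ρ.contDiff_normed.comp (contDiff_const.sub contDiff_id)
  hasCompactSupport' :=
    ρ.hasCompactSupport_normed.comp_homeomorph (Homeomorph.subLeft x)
  tsupport_subset' := by simp

theorem fderiv_bumpSubTest (ρ : ContDiffBump (0 : E)) (x y : E) :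
    fderiv ℝ (bumpSubTest μ ρ x) y = -fderiv ℝ (ρ.normed μ) (x - y) := by
  have h1 : HasFDerivAt (fun y : E => x - y) (-ContinuousLinearMap.id ℝ E) y :=
    (hasFDerivAt_id y).const_sub x
  have h2 := ((ρ.contDiff_normed (n := 1) (μ := μ)).differentiable one_ne_zero (x - y)).hasFDerivAt
  have h3 := (h2.comp y h1).fderiv
  change fderiv ℝ (ρ.normed μ ∘ fun y => x - y) y = _
  rw [h3]
  ext v
  simp

/-- The derivative falls on the bump, whose reflected translate is a test function. The
distributional condition on `f` can thus be tested against it, which makes the derivative of the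
mollified field symmetric. -/
theorem fderiv_mollify_apply (ρ : ContDiffBump (0 : E)) {f : E → StrongDual ℝ E}
    (hf : LocallyIntegrable f μ) (x u v : E) :
    fderiv ℝ (mollify μ ρ f) x u v = -∫ y, f y v * fderiv ℝ (bumpSubTest μ ρ x) y u ∂μ := by
  have hd := ρ.hasCompactSupport_normed.hasFDerivAt_convolution_left
    (ContinuousLinearMap.lsmul ℝ ℝ) (ρ.contDiff_normed (μ := μ)) hf x
  have hint := HasCompactSupport.convolutionExists_left (𝕜 := ℝ) (F := E →L[ℝ] StrongDual ℝ E)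
    ((ContinuousLinearMap.lsmul ℝ ℝ : ℝ →L[ℝ] StrongDual ℝ E →L[ℝ] StrongDual ℝ E).precompL E)
    ((ρ.hasCompactSupport_normed (μ := μ)).fderiv ℝ)
    ((ρ.contDiff_normed (n := 1) (μ := μ)).continuous_fderiv one_ne_zero) hf x
  have h1 : fderiv ℝ (mollify μ ρ f) x u v =
      ∫ t, fderiv ℝ (ρ.normed μ) t u * f (x - t) v ∂μ := by
    rw [show fderiv ℝ (mollify μ ρ f) x = _ from hd.fderiv, convolution_def,
      ContinuousLinearMap.integral_apply hint.integrable,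
      ContinuousLinearMap.integral_apply (hint.integrable.apply_continuousLinearMap u)]
    rfl
  rw [h1, ← integral_sub_left_eq_self _ μ x, ← integral_neg]
  refine integral_congr_ae (Eventually.of_forall fun y => ?_)
  simp only [fderiv_bumpSubTest, sub_sub_cancel, neg_apply]
  ring

/-- A distributionally closed field `f` within distance `r` of `g ∈ C₀` can be replaced, up to
`ε`, by the gradient of a differentiable function. -/
theorem exists_primitive_near {ι : Type*} (b : Module.Basis ι ℝ E) {f : E → StrongDual ℝ E}
    (hfm : AEStronglyMeasurable f μ) (g : C₀(E, StrongDual ℝ E)) {r : ℝ}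
    (hfg : ∀ x, ‖f x - g x‖ ≤ r)
    (hf : ∀ i j : ι, ∀ φ : 𝓓((⊤ : TopologicalSpace.Opens E), ℝ),
      ∫ x, f x (b j) * fderiv ℝ φ x (b i) ∂μ = ∫ x, f x (b i) * fderiv ℝ φ x (b j) ∂μ)
    {ε : ℝ} (hε : 0 < ε) :
    ∃ (F : E → ℝ) (F' : E → StrongDual ℝ E), (∀ x, HasFDerivAt F (F' x) x) ∧
      ∀ x, ‖F' x - g x‖ ≤ r + ε := by
  have hr : 0 ≤ r := (norm_nonneg _).trans (hfg 0)
  obtain ⟨δ, hδ, hgδ⟩ := Metric.uniformContinuous_iff.1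
    (ZeroAtInftyContinuousMap.uniformContinuous g) ε hε
  let ρ : ContDiffBump (0 : E) := ⟨δ / 2, δ, by positivity, by linarith⟩
  have hfi : LocallyIntegrable f μ := by
    refine MemLp.locallyIntegrable (memLp_top_of_bound hfm (r + ‖g.toBCF‖)
      (Eventually.of_forall fun x => ?_)) le_top
    have h1 := norm_add_le (f x - g x) (g x)
    rw [sub_add_cancel] at h1
    exact h1.trans (add_le_add (hfg x) (g.toBCF.norm_coe_le_norm x))
  have hsmooth : ContDiff ℝ 1 (mollify μ ρ f) :=
    ρ.hasCompactSupport_normed.contDiff_convolution_left _ ρ.contDiff_normed hfi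
  have hsymm : ∀ x u v, fderiv ℝ (mollify μ ρ f) x u v = fderiv ℝ (mollify μ ρ f) x v u := by
    intro x
    have hbil : (ContinuousLinearMap.coeLM ℝ).comp (fderiv ℝ (mollify μ ρ f) x).toLinearMap =
        ((ContinuousLinearMap.coeLM ℝ).comp (fderiv ℝ (mollify μ ρ f) x).toLinearMap).flip := by
      refine b.ext fun i => b.ext fun j => ?_
      change fderiv ℝ (mollify μ ρ f) x (b i) (b j) = fderiv ℝ (mollify μ ρ f) x (b j) (b i)
      rw [fderiv_mollify_apply μ ρ hfi, fderiv_mollify_apply μ ρ hfi, hf i j]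
    exact fun u v => LinearMap.congr_fun (LinearMap.congr_fun hbil u) v
  -- Poincaré lemma: a closed one-form on the whole space is exact.
  obtain ⟨F, hF⟩ := convex_univ.exists_forall_hasFDerivAt_of_fderiv_symmetric isOpen_univ
    (hsmooth.differentiable one_ne_zero).differentiableOn fun x _ => hsymm x
  refine ⟨F, mollify μ ρ f, fun x => hF x trivial, fun x => ?_⟩
  rw [← dist_eq_norm]
  refine dist_convolution_le (R := δ) (by positivity) ρ.support_normed_eq.subset ρ.nonneg_normed
    ρ.integral_normed hfm fun y hy => ?_
  exact (dist_triangle _ (g y) _).trans (add_le_add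
    (by rw [dist_eq_norm]; exact hfg y) (hgδ hy).le)

/-- If `∇F` is `r`-close to `g ∈ C₀`, then `g` is almost `r`-close to the gradient of a test
function. -/
theorem exists_testFunction_fderiv_near_of_hasFDerivAt {F : E → ℝ} {F' : E → StrongDual ℝ E}
    (hF : ∀ x, HasFDerivAt F (F' x) x) (g : C₀(E, StrongDual ℝ E)) {r : ℝ}
    (hr : ∀ x, ‖F' x - g x‖ ≤ r) {ε : ℝ} (hε : 0 < ε) :
    ∃ φ : 𝓓((⊤ : TopologicalSpace.Opens E), ℝ), ∀ x, ‖fderiv ℝ φ x - g x‖ ≤ r + ε := by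
  have hr0 : 0 ≤ r := (norm_nonneg _).trans (hr 0)
  obtain ⟨δ, hδ, hgδ⟩ := Metric.uniformContinuous_iff.1
    (ZeroAtInftyContinuousMap.uniformContinuous g) (ε / 2) (by positivity)
  obtain ⟨R, hR⟩ : ∃ R, ∀ x, R < ‖x‖ → ‖g x‖ < ε / 2 := by
    have h := (zero_at_infty g).norm.eventually_lt_const
      (show ‖(0 : StrongDual ℝ E)‖ < ε / 2 by simpa using by positivity)
    obtain ⟨K, hK, hKg⟩ := mem_cocompact.1 h
    obtain ⟨R, hR⟩ := hK.isBounded.exists_norm_le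
    exact ⟨R, fun x hx => hKg fun hxK => (hR x hxK).not_gt hx⟩
  obtain ⟨G, C, hG, hc, hGF, hGL⟩ := exists_hasCompactSupport_truncation
    (continuous_iff_continuousAt.2 fun x => (hF x).continuousAt)
    (show 0 < r + ε / 2 by positivity) (R + 2 * δ)
  let ρ : ContDiffBump (0 : E) := ⟨δ / 4, δ / 2, by positivity, by linarith⟩
  refine ⟨mollifyTest Measure.addHaar ρ hG hc, fun x => ?_⟩
  have hlip : ∀ (A : StrongDual ℝ E) (K : ℝ), (∀ y ∈ ball x δ, ‖F' y - A‖ ≤ K) →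
      ∀ y ∈ ball x δ, ∀ z ∈ ball x δ, |F y - F z - A (y - z)| ≤ K * ‖y - z‖ := by
    intro A K hK y hy z hz
    have := (convex_ball x δ).norm_image_sub_le_of_norm_hasFDerivWithin_le' (f := F) (φ := A)
      (fun w _ => (hF w).hasFDerivWithinAt) hK hz hy
    simpa using this
  -- If so, `ball x δ` lies where `G = F + C`, and `g` varies there by less than `ε / 2`. Otherwise
  -- it lies where `‖g‖ < ε / 2`, so F is `(r + ε / 2)`-Lipschitz there; `G` inherits this even
  -- where it differs from `F + C`, and comparing with `g x` costs another `ε / 2`.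
  by_cases hx : ‖x‖ ≤ R + δ
  · refine norm_fderiv_mollify_sub_le _ ρ hG (g x) (K := r + ε) (by positivity) (δ := δ)
      (half_lt_self hδ) fun y hy z hz => ?_
    have hball : ∀ y ∈ ball x δ, G y = F y + C := fun y hy => hGF y <| by
      rw [mem_closedBall_zero_iff]
      rw [mem_ball_iff_norm] at hy
      linarith [norm_le_norm_add_norm_sub' y x]
    rw [hball y hy, hball z hz, add_sub_add_right_eq_sub]
    refine hlip (g x) (r + ε) (fun w hw => ?_) y hy z hz
    have h1 := norm_add_le (F' w - g w) (g w - g x)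
    have h2 := hgδ hw
    rw [dist_eq_norm] at h2
    rw [sub_add_sub_cancel] at h1
    linarith [hr w]
  · rw [not_le] at hx
    have hball : ∀ y ∈ ball x δ, R < ‖y‖ := fun y hy => by
      rw [mem_ball_iff_norm'] at hy
      linarith [norm_le_norm_add_norm_sub' x y]
    have h0 : ‖fderiv ℝ (mollify Measure.addHaar ρ G) x - 0‖ ≤ r + ε / 2 := by
      refine norm_fderiv_mollify_sub_le _ ρ hG 0 (by positivity) (δ := δ)
        (half_lt_self hδ) fun y hy z hz => ?_
      have h1 := hlip 0 (r + ε / 2) (fun w hw => by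
        have h2 := norm_add_le (F' w - g w) (g w)
        rw [sub_add_cancel] at h2
        rw [sub_zero]
        linarith [hr w, hR w (hball w hw)]) y hy z hz
      rw [zero_apply, sub_zero] at h1 ⊢
      exact hGL y z h1
    rw [sub_zero] at h0
    have h1 := norm_sub_le (fderiv ℝ (mollify Measure.addHaar ρ G) x) (g x)
    rw [coe_mollifyTest]
    linarith [hR x (hball x (mem_ball_self hδ))]

end CurlFree

/-! ### Passage to classes in L^∞ and conclusion -/

section Density

variable {E : Type*} [NormedAddCommGroup E] [NormedSpace ℝ E] [FiniteDimensional ℝ E]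
  [MeasurableSpace E] [BorelSpace E]

theorem coeFn_c0ToLinfty (μ : Measure E) (g : C₀(E, StrongDual ℝ E)) :
    c0ToLinfty μ g =ᵐ[μ] g :=
  MemLp.coeFn_toLp _

theorem ae_norm_sub_le_dist_c0ToLinfty {μ : Measure E} (f : Lp (StrongDual ℝ E) ∞ μ)
    (g : C₀(E, StrongDual ℝ E)) : ∀ᵐ x ∂μ, ‖f x - g x‖ ≤ dist f (c0ToLinfty μ g) := by
  rw [dist_eq_norm]
  have h := ae_le_eLpNormEssSup (f := ⇑(f - c0ToLinfty μ g)) (μ := μ)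
  filter_upwards [h, Lp.coeFn_sub f (c0ToLinfty μ g), coeFn_c0ToLinfty μ g] with x h1 h2 h3
  rw [h2, Pi.sub_apply, h3] at h1
  rw [Lp.norm_def, eLpNorm_exponent_top, ← toReal_enorm]
  refine ENNReal.toReal_mono ?_ h1
  rw [← eLpNorm_exponent_top]
  exact (Lp.memLp _).eLpNorm_ne_top

theorem dist_c0ToLinfty_le {μ : Measure E} {g h : C₀(E, StrongDual ℝ E)} {K : ℝ} (hK : 0 ≤ K)
    (hgh : ∀ x, ‖g x - h x‖ ≤ K) : dist (c0ToLinfty μ g) (c0ToLinfty μ h) ≤ K := by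
  rw [dist_eq_norm, Lp.norm_def, eLpNorm_exponent_top]
  refine ENNReal.toReal_le_of_le_ofReal hK (eLpNormEssSup_le_of_ae_bound ?_)
  filter_upwards [Lp.coeFn_sub (c0ToLinfty μ g) (c0ToLinfty μ h), coeFn_c0ToLinfty μ g,
    coeFn_c0ToLinfty μ h] with x h1 h2 h3
  rw [h1, Pi.sub_apply, h2, h3]
  exact hgh x

/-- A field `g ∈ C₀` is almost as close to the gradients of test functions as to any given element
of `X(E)`. -/
theorem exists_testGradient_dist_le {d : ℕ} (b : Module.Basis (Fin d) ℝ E)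
    {f : Lp (StrongDual ℝ E) ∞ b.addHaar} (hf : f ∈ curlFree b) (g : C₀(E, StrongDual ℝ E))
    {ε : ℝ} (hε : 0 < ε) :
    ∃ φ : 𝓓((⊤ : TopologicalSpace.Opens E), ℝ),
      dist (c0ToLinfty b.addHaar g) (c0ToLinfty b.addHaar (testGradient φ)) ≤
        dist (c0ToLinfty b.addHaar g) f + ε := by
  classical
  set r := dist (c0ToLinfty b.addHaar g) f with hr
  -- A representative of `f` for which the bound by `r` holds at every point, not just almost
  -- everywhere.
  let f₀ : E → StrongDual ℝ E := fun x => if ‖f x - g x‖ ≤ r then f x else g x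
  have hff₀ : f =ᵐ[b.addHaar] f₀ := by
    filter_upwards [ae_norm_sub_le_dist_c0ToLinfty f g] with x hx
    rw [dist_comm] at hx
    exact (if_pos hx).symm
  have hf₀r : ∀ x, ‖f₀ x - g x‖ ≤ r := by
    intro x
    by_cases hx : ‖f x - g x‖ ≤ r
    · simpa only [f₀, if_pos hx] using hx
    · simpa only [f₀, if_neg hx, sub_self, norm_zero] using dist_nonneg
  have hint : ∀ (i j : Fin d) (φ : 𝓓((⊤ : TopologicalSpace.Opens E), ℝ)),
      ∫ x, f₀ x (b j) * fderiv ℝ φ x (b i) ∂b.addHaar =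
        ∫ x, f x (b j) * fderiv ℝ φ x (b i) ∂b.addHaar := fun i j φ =>
    integral_congr_ae (hff₀.mono fun x hx => by simp only [hx])
  obtain ⟨F, F', hF, hF'⟩ := exists_primitive_near b.addHaar b
    ((Lp.memLp f).aestronglyMeasurable.congr hff₀) g hf₀r
    (fun i j φ => by rw [hint, hint]; exact hf i j φ) (half_pos hε)
  obtain ⟨φ, hφ⟩ := exists_testFunction_fderiv_near_of_hasFDerivAt hF g hF' (half_pos hε)
  refine ⟨φ, ?_⟩
  rw [dist_comm]
  refine dist_c0ToLinfty_le (by positivity) fun x => ?_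
  have := hφ x
  rw [add_assoc, add_halves] at this
  exact this

/-- Integrating by parts moves the derivative from `ψ` onto `φ`, whose second derivative is
symmetric. -/
theorem integral_fderiv_mul_fderiv_comm (μ : Measure E) [μ.IsAddHaarMeasure]
    (φ ψ : 𝓓((⊤ : TopologicalSpace.Opens E), ℝ)) (u v : E) :
    ∫ x, fderiv ℝ φ x v * fderiv ℝ ψ x u ∂μ = ∫ x, fderiv ℝ φ x u * fderiv ℝ ψ x v ∂μ := by
  have hφ2 : ContDiff ℝ 2 φ := contDiff_infty.1 φ.contDiff 2
  have hψ1 : ContDiff ℝ 1 ψ := contDiff_infty.1 ψ.contDiff 1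
  have hd : ∀ w : E, ContDiff ℝ 1 fun x => fderiv ℝ φ x w := fun w =>
    (hφ2.fderiv_right (by norm_num)).clm_apply contDiff_const
  have hψ' : ∀ w : E, Continuous fun x => fderiv ℝ ψ x w := fun w =>
    (hψ1.continuous_fderiv one_ne_zero).clm_apply continuous_const
  have hcψ' : ∀ w : E, HasCompactSupport fun x => fderiv ℝ ψ x w := fun w =>
    ψ.hasCompactSupport.fderiv_apply ℝ w
  have hparts : ∀ w z : E, ∫ x, fderiv ℝ φ x w * fderiv ℝ ψ x z ∂μ =
      -∫ x, fderiv ℝ (fun y => fderiv ℝ φ y w) x z * ψ x ∂μ := fun w z =>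
    integral_mul_fderiv_eq_neg_fderiv_mul_of_integrable
      ((((hd w).continuous_fderiv one_ne_zero).clm_apply continuous_const).mul
        ψ.continuous |>.integrable_of_hasCompactSupport ψ.hasCompactSupport.mul_left)
      (((hd w).continuous.mul (hψ' z)).integrable_of_hasCompactSupport (hcψ' z).mul_left)
      (((hd w).continuous.mul ψ.continuous).integrable_of_hasCompactSupport
        ψ.hasCompactSupport.mul_left)
      (fun x _ => (hd w).differentiable one_ne_zero x)
      (fun x _ => hψ1.differentiable one_ne_zero x)
  rw [hparts, hparts]
  congr 2
  ext x
  have hdx : DifferentiableAt ℝ (fderiv ℝ φ) x :=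
    (hφ2.fderiv_right (m := 1) (by norm_num)).differentiable one_ne_zero x
  have hsymm : fderiv ℝ (fderiv ℝ φ) x u v = fderiv ℝ (fderiv ℝ φ) x v u :=
    hφ2.contDiffAt.isSymmSndFDerivAt (by simp) u v
  rw [fderiv_clm_apply hdx (differentiableAt_const _),
    fderiv_clm_apply hdx (differentiableAt_const _)]
  simp [hsymm]

theorem c0ToLinfty_testGradient_mem_curlFree {d : ℕ} (b : Module.Basis (Fin d) ℝ E)
    (φ : 𝓓((⊤ : TopologicalSpace.Opens E), ℝ)) :
    c0ToLinfty b.addHaar (testGradient φ) ∈ curlFree b := by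
  intro i j ψ
  have hint : ∀ i j : Fin d,
      ∫ x, c0ToLinfty b.addHaar (testGradient φ) x (b j) * fderiv ℝ ψ x (b i) ∂b.addHaar =
        ∫ x, fderiv ℝ φ x (b j) * fderiv ℝ ψ x (b i) ∂b.addHaar := fun i j =>
    integral_congr_ae ((coeFn_c0ToLinfty b.addHaar (testGradient φ)).mono fun x hx => by
      simp only [hx]; rfl)
  rw [hint, hint]
  exact integral_fderiv_mul_fderiv_comm _ φ ψ _ _

theorem gradientSet_subset {d : ℕ} (b : Module.Basis (Fin d) ℝ E) :
    gradientSet b.addHaar ⊆ c0Set b.addHaar ∩ curlFree b := by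
  rintro _ ⟨φ, rfl⟩
  exact ⟨⟨_, rfl⟩, c0ToLinfty_testGradient_mem_curlFree b φ⟩

end Density

theorem propositionP {E : Type*} [NormedAddCommGroup E] [NormedSpace ℝ E] [FiniteDimensional ℝ E]
    [MeasurableSpace E] [BorelSpace E] (d : ℕ) (hd : 2 ≤ d) (b : Module.Basis (Fin d) ℝ E) :
    (∀ F : Lip0 E, ∃ Fn : ℕ → 𝓓((⊤ : TopologicalSpace.Opens E), ℝ),
      (∀ n, lipConst (Fn n) ≤ ‖F‖) ∧
      Tendsto (fun n => (testToLip0 (Fn n)).toWeakDual) atTop (𝓝 F.toWeakDual)) ∧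
    (gradientSet b.addHaar ⊆ c0Set b.addHaar ∩ curlFree b ∧
      c0Set b.addHaar ∩ curlFree b ⊆ closure (gradientSet b.addHaar)) ∧
    (∀ g : C₀(E, StrongDual ℝ E),
      Metric.infDist (c0ToLinfty b.addHaar g) (curlFree b) =
        Metric.infDist (c0ToLinfty b.addHaar g) (curlFree b ∩ c0Set b.addHaar)) := by
  refine ⟨Lip0.exists_seq_testFunction_tendsto, ⟨gradientSet_subset b, ?_⟩, fun g => ?_⟩
  · rintro _ ⟨⟨g, rfl⟩, hg⟩
    refine Metric.mem_closure_iff.2 fun ε hε => ?_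
    obtain ⟨φ, hφ⟩ := exists_testGradient_dist_le b hg g (half_pos hε)
    -- Here `g` itself lies in X(E), so it serves as its own `f`, at distance zero.
    rw [dist_self, zero_add] at hφ
    exact ⟨_, ⟨φ, rfl⟩, hφ.trans_lt (half_lt_self hε)⟩
  · have hne : (curlFree b ∩ c0Set b.addHaar).Nonempty :=
      ⟨_, (gradientSet_subset b ⟨0, rfl⟩).symm⟩
    refine le_antisymm (infDist_le_infDist_of_subset Set.inter_subset_left hne) ?_
    refine (le_infDist (hne.mono Set.inter_subset_left)).2 ?_
    intro f hf
    refine le_of_forall_pos_le_add fun ε hε => ?_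
    obtain ⟨φ, hφ⟩ := exists_testGradient_dist_le b hf g hε
    have hmem := gradientSet_subset b ⟨φ, rfl⟩
    exact (infDist_le_dist_of_mem (s := curlFree b ∩ c0Set b.addHaar) hmem.symm).trans hφ
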